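/- Let $G$ be a finite commutative ring and $m$ a positive integer. For a finite sequence $S=(g_1,\dots,g_\ell)$ over $G$ (order disregarded, repetition allowed) put $e_m(S)=\sum_{1\le i_1<\dots<i_m\le \ell} g_{i_1}\cdots g_{i_m}$ (so $e_m(S)=0$ if $\ell<m$). For a positive integer $t$, let $\mathsf{EGZ}_t(G,m)$ be the smallest positive integer $z$ such that every sequence $S$ over $G$ of length $|S|\ge z$ contains a subsequence $S'$ of length exactly $t$ with $e_m(S')=0$, and put $\mathsf{EGZ}_t(G,m)=\infty$ if no such $z$ exists. Let $\mathsf{D}_m(G)$ be the smallest positive integer $z$ such that every sequence $S$ over $G$ of length $|S|\ge z$ contains a subsequence $S'$ of length $|S'|\ge m$ with $e_m(S')=0$. Write $\mathbb{Z}_k=\mathbb{Z}/k\mathbb{Z}$, and let $\mathbb{Z}_k^d$ be the direct product of $d$ copies of this ring, with coordinatewise operations. **Theorem.** 1. Let $k,m$ be positive integers with $\gcd(k,m!)=1$. Then $\mathsf{EGZ}_k(\mathbb{Z}_k,m)\le \mathsf{EGZ}_k\bigl(\mathbb{Z}_k^{\lceil (m+1)/2\rceil},1\bigr)$. Moreover,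 if $k$ is a positive integer with $\gcd(k,3)=1$, then $\mathsf{EGZ}_k(\mathbb{Z}_k,3)\le 4k-3$. 2. Let $k\ne 2$ be a positive integer with $\gcd(k,3)=1$. Then $\mathsf{EGZ}_k(\mathbb{Z}_k,3)\ge k+\mathsf{D}_3(\mathbb{Z}_k)-3$. 3. Let $q$ be a prime power, that is, $q=p^\alpha$ with $p$ prime and $\alpha\ge 1$. Then $\mathsf{EGZ}_q(\mathbb{Z}_q,3)\ge 2q-3$. -/

import Mathlib

/-- The `m`-th degree Erdős–Ginzburg–Ziv constant `EGZ_t(G, m)`: the smallest positive integer `z`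
such that every sequence `S` over `G` (order disregarded, repetition allowed) of length at least `z`
has a subsequence `S'` of length `t` with `e_m(S') = 0`; it is `⊤` if there is no such `z`. -/
noncomputable def egzConst (t : ℕ) (G : Type*) [CommRing G] (m : ℕ) : ℕ∞ :=
  sInf ((fun z : ℕ => (z : ℕ∞)) '' {z : ℕ | 0 < z ∧ ∀ S : Multiset G, z ≤ S.card →
    ∃ S' : Multiset G, S' ≤ S ∧ S'.card = t ∧ S'.esymm m = 0})

/-- The `m`-th degree Davenport constant `D_m(G)`: the smallest positive integer `z` such that every
sequence `S` over `G` of length at least `z` has a subsequence `S'` of length at least `m` with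
`e_m(S') = 0` (and `⊤` if there is no such `z`). -/
noncomputable def davenportConst (m : ℕ) (G : Type*) [CommRing G] : ℕ∞ :=
  sInf ((fun z : ℕ => (z : ℕ∞)) '' {z : ℕ | 0 < z ∧ ∀ S : Multiset G, z ≤ S.card →
    ∃ S' : Multiset G, S' ≤ S ∧ m ≤ S'.card ∧ S'.esymm m = 0})

/-! Upper bounds: by Newton's identities, `m * e_m` is a signed sum of products `e_i * p_(m-i)` with
`i < m`. If the power sums `p_1, ..., p_⌊m/2⌋` and `p_m` vanish, every product has a zero factor,
and invertibility of `m!` gives `e_m = 0`. A zero-sum problem for the vectors `(g, ..., g^⌊m/2⌋,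
g^m)` therefore suffices. For `m = 3` these are the pairs `(g, g^3)`, only 3 must be invertible, and
the Kemnitz conjecture (`Kemnitz.exists_dvd_sum`) gives `4k - 3`. It is proved by Reiher's argument:
congruences mod `p` for the numbers of zero-sum subsets of given sizes contradict each other unless
some zero-sum `p`-subset exists; composite `n` follows by grouping.

Lower bounds: zeros do not affect `e_m`, so padding a sequence with `k - m` of them turns an EGZ
subsequence into a Davenport one (`add_davenportConst_le_egzConst`). A sequence of `q - 1` ones
shows `D_3 ≥ q`, since `q` does not divide `n.choose 3` for `3 ≤ n < q`. -/

namespace Kemnitz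

open Finset

/-! ### Alternating sums over cubes and residue classes -/

section SignedSum

variable {ι R : Type*} [DecidableEq ι] [CommRing R]

/-- The alternating sum of a polynomial over the vertices of a cube of dimension larger than its
degree vanishes. -/
lemma sum_neg_one_pow_card_mul_eval (J : Finset ι) (P : MvPolynomial ι R)
    (h : P.totalDegree < #J) :
    ∑ I ∈ J.powerset, (-1) ^ #I * MvPolynomial.eval (fun i => if i ∈ I then 1 else 0) P = 0 := by
  simp_rw [MvPolynomial.eval_eq, mul_sum]
  rw [sum_comm]
  refine sum_eq_zero fun d hd => ?_
  have hcard : #d.support < #J := by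
    refine lt_of_le_of_lt ?_ ((MvPolynomial.le_totalDegree hd).trans_lt h)
    rw [card_eq_sum_ones]
    exact sum_le_sum fun i hi => Nat.one_le_iff_ne_zero.2 (Finsupp.mem_support_iff.1 hi)
  -- The monomial `d` omits some variable `j` of `J`; toggling `j` in `I` changes only the sign, so
  -- the terms cancel in pairs.
  obtain ⟨j, hjJ, hjd⟩ := exists_mem_notMem_of_card_lt_card hcard
  rw [← insert_erase hjJ, sum_powerset_insert (notMem_erase j J), ← sum_add_distrib]
  refine sum_eq_zero fun I hI => ?_
  have hjI : j ∉ I := fun hj => notMem_erase j J (mem_powerset.1 hI hj)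
  have : ∏ i ∈ d.support, (if i ∈ insert j I then (1 : R) else 0) ^ d i =
      ∏ i ∈ d.support, (if i ∈ I then (1 : R) else 0) ^ d i := by
    refine prod_congr rfl fun i hi => ?_
    have : i ≠ j := fun hij => hjd (hij ▸ hi)
    simp [this]
  rw [this, card_insert_of_notMem hjI, pow_succ]
  ring

lemma sum_range_four_mul {M : Type*} [AddCommMonoid M] {p r : ℕ} (hr : r < p) (g : ℕ → M)
    (hg : ∀ n, n % p ≠ r → g n = 0) :
    ∑ n ∈ range (4 * p), g n = g r + g (p + r) + g (2 * p + r) + g (3 * p + r) := by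
  have key : ∀ c, ∑ n ∈ range p, g (c * p + n) = g (c * p + r) := fun c => by
    refine sum_eq_single r (fun n hn hne => hg _ ?_) (fun h => absurd (mem_range.2 hr) h)
    rwa [Nat.mul_add_mod', Nat.mod_eq_of_lt (mem_range.1 hn)]
  have h0 := key 0
  have h1 := key 1
  simp only [zero_mul, zero_add, one_mul] at h0 h1
  rw [show 4 * p = p + p + p + p by ring, sum_range_add, sum_range_add, sum_range_add, h0, h1,
    ← two_mul, key 2, show 2 * p + p = 3 * p by ring, key 3]

end SignedSum

/-! ### Double counting of disjoint subsets -/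

section Disjoint

variable {ι M : Type*} [DecidableEq ι] [AddCommMonoid M]

lemma sum_powersetCard_sdiff_comm (J : Finset ι) (m n : ℕ) (F : Finset ι → Finset ι → M) :
    ∑ A ∈ powersetCard m J, ∑ B ∈ powersetCard n (J \ A), F A B =
      ∑ B ∈ powersetCard n J, ∑ A ∈ powersetCard m (J \ B), F A B := by
  refine sum_comm' fun A B => ?_
  simp only [mem_powersetCard, subset_sdiff, disjoint_comm (a := A) (b := B)]
  tauto

lemma sum_powersetCard_compl {J : Finset ι} {m n : ℕ} (h : m + n = #J) (F : Finset ι → M) :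
    ∑ A ∈ powersetCard m J, F (J \ A) = ∑ A ∈ powersetCard n J, F A := by
  refine sum_bij' (fun A _ => J \ A) (fun A _ => J \ A) ?_ ?_ ?_ ?_ ?_
  · intro A hA
    rw [mem_powersetCard] at hA ⊢
    refine ⟨sdiff_subset, ?_⟩
    rw [card_sdiff_of_subset hA.1]
    omega
  · intro A hA
    rw [mem_powersetCard] at hA ⊢
    refine ⟨sdiff_subset, ?_⟩
    rw [card_sdiff_of_subset hA.1]
    omega
  · intro A hA
    exact Finset.sdiff_sdiff_eq_self (mem_powersetCard.1 hA).1
  · intro A hA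
    exact Finset.sdiff_sdiff_eq_self (mem_powersetCard.1 hA).1
  · intros; rfl

end Disjoint

/-! ### Reiher's theorem for a prime -/

section Prime

variable {ι : Type*} {p : ℕ}

/-- The indicator of the zero-sum index sets of a sequence of points `(a i, b i)`. -/
def zeroSum (a b : ι → ZMod p) (I : Finset ι) : ZMod p :=
  if ∑ i ∈ I, a i = 0 ∧ ∑ i ∈ I, b i = 0 then 1 else 0

/-- The number, modulo `p`, of zero-sum `n`-subsets of `J`. -/
def count (a b : ι → ZMod p) (n : ℕ) (J : Finset ι) : ZMod p :=
  ∑ I ∈ powersetCard n J, zeroSum a b I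

variable {a b : ι → ZMod p}

lemma count_zero (J : Finset ι) : count a b 0 J = 1 := by
  rw [count, powersetCard_zero, sum_singleton]
  simp [zeroSum]

lemma count_eq_zero_of_card_lt {n : ℕ} {J : Finset ι} (h : #J < n) : count a b n J = 0 := by
  simp [count, powersetCard_eq_empty.2 h]

lemma exists_of_count_ne_zero {n : ℕ} {J : Finset ι} (h : count a b n J ≠ 0) :
    ∃ I ⊆ J, #I = n ∧ zeroSum a b I = 1 := by
  obtain ⟨I, hI, hne⟩ := exists_ne_zero_of_sum_ne_zero h
  rw [mem_powersetCard] at hI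
  refine ⟨I, hI.1, hI.2, ?_⟩
  by_contra hcon
  unfold zeroSum at hne hcon
  split_ifs at hne hcon <;> simp_all

lemma zeroSum_eq_one_iff [Fact p.Prime] {I : Finset ι} :
    zeroSum a b I = 1 ↔ ∑ i ∈ I, a i = 0 ∧ ∑ i ∈ I, b i = 0 := by
  unfold zeroSum
  split_ifs with h <;> simp [h]

lemma zeroSum_mul_zeroSum_sdiff [DecidableEq ι] {C D : Finset ι} (h : C ⊆ D) :
    zeroSum a b D * zeroSum a b C = zeroSum a b C * zeroSum a b (D \ C) := by
  unfold zeroSum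
  rw [← sum_sdiff h, ← sum_sdiff h (f := b)]
  by_cases h1 : ∑ i ∈ C, a i = 0 <;> by_cases h2 : ∑ i ∈ C, b i = 0 <;> simp [h1, h2]

/-- A zero-sum `n`-subset of `J` avoids exactly `(#J - n).choose m` of the `m`-subsets `B`. -/
lemma sum_count_sdiff [DecidableEq ι] (J : Finset ι) (m n : ℕ) :
    ∑ B ∈ powersetCard m J, count a b n (J \ B) = ((#J - n).choose m : ZMod p) * count a b n J := by
  unfold count
  rw [sum_powersetCard_sdiff_comm, mul_sum]
  refine sum_congr rfl fun A hA => ?_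
  rw [mem_powersetCard] at hA
  rw [sum_const, card_powersetCard, card_sdiff_of_subset hA.1, hA.2, nsmul_eq_mul]

variable [hp : Fact p.Prime]

lemma zeroSum_eq_mul (I : Finset ι) : zeroSum a b I =
    (1 - (∑ i ∈ I, a i) ^ (p - 1)) * (1 - (∑ i ∈ I, b i) ^ (p - 1)) := by
  unfold zeroSum
  simp only [ZMod.pow_card_sub_one]
  split_ifs <;> simp_all

lemma totalDegree_one_sub_linear_pow_le (J : Finset ι) (c : ι → ZMod p) :
    (1 - (∑ i ∈ J, MvPolynomial.C (c i) * MvPolynomial.X i) ^ (p - 1)).totalDegree ≤ p - 1 := by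
  refine (MvPolynomial.totalDegree_sub _ _).trans (max_le (by simp) ?_)
  refine (MvPolynomial.totalDegree_pow _ _).trans ?_
  refine (Nat.mul_le_mul_left _ (MvPolynomial.totalDegree_finsetSum_le (d := 1) fun i _ => ?_)).trans
    (by simp)
  exact (MvPolynomial.totalDegree_mul _ _).trans (by simp)

/-- By Fermat, `zeroSum` is a polynomial of degree at most `2(p - 1)` in the indicator variables.
The factor `h` of the subset size is used below to select residue classes mod `p`. -/
lemma sum_neg_one_pow_card_mul_zeroSum (a b : ι → ZMod p) (J : Finset ι)
    (h : Polynomial (ZMod p)) (hJ : 2 * (p - 1) + h.natDegree < #J) :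
    ∑ I ∈ J.powerset, (-1) ^ #I * (zeroSum a b I * h.eval (#I : ZMod p)) = 0 := by
  classical
  let l : (ι → ZMod p) → MvPolynomial ι (ZMod p) :=
    fun c => ∑ i ∈ J, MvPolynomial.C (c i) * MvPolynomial.X i
  let H : MvPolynomial ι (ZMod p) :=
    ∑ d ∈ range (h.natDegree + 1), MvPolynomial.C (h.coeff d) * l 1 ^ d
  have hl : (l 1).totalDegree ≤ 1 := MvPolynomial.totalDegree_finsetSum_le fun i _ =>
    (MvPolynomial.totalDegree_mul _ _).trans (by simp)
  have hH : H.totalDegree ≤ h.natDegree := by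
    refine MvPolynomial.totalDegree_finsetSum_le fun d hd => ?_
    refine (MvPolynomial.totalDegree_mul _ _).trans ?_
    rw [MvPolynomial.totalDegree_C, zero_add]
    refine (MvPolynomial.totalDegree_pow _ _).trans ?_
    have := Nat.mul_le_mul_left d hl
    have := mem_range.1 hd
    omega
  have key := sum_neg_one_pow_card_mul_eval J
    ((1 - l a ^ (p - 1)) * (1 - l b ^ (p - 1)) * H) (by
      refine lt_of_le_of_lt ?_ hJ
      have h1 := totalDegree_one_sub_linear_pow_le J a
      have h2 := totalDegree_one_sub_linear_pow_le J b
      have h3 := MvPolynomial.totalDegree_mul ((1 - l a ^ (p - 1)) * (1 - l b ^ (p - 1))) H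
      have h4 := MvPolynomial.totalDegree_mul (1 - l a ^ (p - 1)) (1 - l b ^ (p - 1))
      simp only [l] at *
      omega)
  rw [← key]
  refine sum_congr rfl fun I hI => ?_
  have hIJ := mem_powerset.1 hI
  have hlin : ∀ c : ι → ZMod p,
      MvPolynomial.eval (fun i => if i ∈ I then 1 else 0) (l c) = ∑ i ∈ I, c i := fun c => by
    simp only [l, map_sum, map_mul, MvPolynomial.eval_C, MvPolynomial.eval_X, mul_ite, mul_one,
      mul_zero]
    rw [sum_ite_mem, inter_eq_right.2 hIJ]
  congr 1
  simp only [map_mul, map_sub, map_pow, map_one, hlin, H, map_sum, MvPolynomial.eval_C,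
    zeroSum_eq_mul, Polynomial.eval_eq_sum_range, Pi.one_apply, sum_const, nsmul_eq_mul, mul_one]

lemma sum_range_neg_one_pow_mul_count (a b : ι → ZMod p) {J : Finset ι} (h : Polynomial (ZMod p))
    (hJ : 2 * (p - 1) + h.natDegree < #J) (hJ' : #J < 4 * p) :
    ∑ n ∈ range (4 * p), (-1) ^ n * (h.eval (n : ZMod p) * count a b n J) = 0 := by
  rw [← sum_neg_one_pow_card_mul_zeroSum a b J h hJ, sum_powerset]
  rw [← sum_subset (range_mono (Nat.succ_le_of_lt hJ')) fun n _ hn => by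
    rw [count_eq_zero_of_card_lt (by simpa using hn)]; simp]
  refine sum_congr rfl fun n _ => ?_
  rw [count, mul_sum, mul_sum]
  refine sum_congr rfl fun I hI => ?_
  rw [(mem_powersetCard.1 hI).2]
  ring

/-- The polynomial `1 - (X - r)^(p-1)` is the indicator of sizes congruent to `r`. -/
lemma count_alternating (a b : ι → ZMod p) {J : Finset ι} {r : ℕ} (hr : r < p)
    (hJ : 3 * (p - 1) < #J) (hJ' : #J < 4 * p) :
    (-1) ^ r * count a b r J + (-1) ^ (p + r) * count a b (p + r) J +
      (-1) ^ (2 * p + r) * count a b (2 * p + r) J +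
      (-1) ^ (3 * p + r) * count a b (3 * p + r) J = 0 := by
  have hdeg : (1 - (Polynomial.X - Polynomial.C (r : ZMod p)) ^ (p - 1)).natDegree ≤ p - 1 := by
    refine (Polynomial.natDegree_sub_le _ _).trans (max_le (by simp) ?_)
    refine Polynomial.natDegree_pow_le.trans ?_
    rw [Polynomial.natDegree_X_sub_C, mul_one]
  have key := sum_range_neg_one_pow_mul_count a b (J := J)
    (1 - (Polynomial.X - Polynomial.C (r : ZMod p)) ^ (p - 1)) (by omega) hJ'
  rw [sum_range_four_mul hr] at key
  · simpa [(Nat.sub_pos_of_lt hp.out.one_lt).ne'] using key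
  · intro n hn
    have : (n : ZMod p) - r ≠ 0 := by
      rw [sub_ne_zero, Ne, ZMod.natCast_eq_natCast_iff', Nat.mod_eq_of_lt hr]
      exact hn
    simp [ZMod.pow_card_sub_one_eq_one this]

lemma count_alternating_zero (a b : ι → ZMod p) (hodd : Odd p) {J : Finset ι}
    (hJ : 3 * (p - 1) < #J) (hJ' : #J < 4 * p) :
    1 - count a b p J + count a b (2 * p) J - count a b (3 * p) J = 0 := by
  have key := count_alternating a b hp.out.pos hJ hJ'
  have h3 : Odd (3 * p) := Odd.mul (by decide) hodd
  simp only [add_zero, count_zero, hodd.neg_one_pow, (even_two_mul p).neg_one_pow,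
    h3.neg_one_pow, pow_zero] at key
  linear_combination key

lemma count_alternating_pred (a b : ι → ZMod p) (hodd : Odd p) {J : Finset ι}
    (hJ : 3 * (p - 1) < #J) (hJ' : #J < 4 * p - 1) :
    count a b (p - 1) J - count a b (2 * p - 1) J + count a b (3 * p - 1) J = 0 := by
  have hpos : 1 ≤ p := hp.out.pos
  have key := count_alternating a b (Nat.sub_lt hpos one_pos) hJ (by omega)
  rw [← Nat.add_sub_assoc hpos, ← Nat.add_sub_assoc hpos, ← Nat.add_sub_assoc hpos,
    show p + p - 1 = 2 * p - 1 by omega, show 2 * p + p - 1 = 3 * p - 1 by omega,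
    show 3 * p + p - 1 = 4 * p - 1 by omega, count_eq_zero_of_card_lt (n := 4 * p - 1) hJ'] at key
  obtain ⟨t, rfl⟩ := hodd
  have h1 : Even (2 * t + 1 - 1) := ⟨t, by omega⟩
  have h2 : Odd (2 * (2 * t + 1) - 1) := ⟨2 * t, by omega⟩
  have h3 : Even (3 * (2 * t + 1) - 1) := ⟨3 * t + 1, by omega⟩
  rw [h1.neg_one_pow, h2.neg_one_pow, h3.neg_one_pow] at key
  linear_combination key

lemma count_alternating_of_card_eq (a b : ι → ZMod p) (hodd : Odd p) {J : Finset ι}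
    (hJ : #J = 3 * p - 3) :
    1 - count a b (p - 1) J - count a b p J + count a b (2 * p - 1) J + count a b (2 * p) J
      = 0 := by
  have h2 := hp.out.two_le
  have hpos : 1 ≤ p := hp.out.pos
  -- The leading terms cancel, which saves one degree and so permits `#J = 3p - 3`. The value at `n`
  -- is `[n ≡ 0] - [n ≡ -1]`.
  let h : Polynomial (ZMod p) := (Polynomial.X + Polynomial.C 1) ^ (p - 1) - Polynomial.X ^ (p - 1)
  have hdeg : h.natDegree < p - 1 := by
    by_cases h0 : h = 0
    · rw [h0, Polynomial.natDegree_zero]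
      omega
    have := Polynomial.degree_sub_lt_left (p := (Polynomial.X + Polynomial.C (1 : ZMod p)) ^ (p - 1))
      (q := Polynomial.X ^ (p - 1))
      (by rw [Polynomial.degree_pow, Polynomial.degree_X_add_C, Polynomial.degree_X_pow]; simp)
      (((Polynomial.monic_X_add_C 1).pow _).ne_zero)
      (by rw [((Polynomial.monic_X_add_C (1 : ZMod p)).pow _).leadingCoeff,
            (Polynomial.monic_X_pow _).leadingCoeff])
    have := Polynomial.natDegree_lt_natDegree h0 this
    rwa [Polynomial.natDegree_pow, Polynomial.natDegree_X_add_C, mul_one] at this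
  have key := sum_range_neg_one_pow_mul_count a b (J := J) h (by omega) (by omega)
  have heval : ∀ n : ℕ, h.eval (n : ZMod p) =
      (if n % p = 0 then 1 else 0) - (if n % p = p - 1 then 1 else 0) := fun n => by
    have e1 : (n : ZMod p) = 0 ↔ n % p = 0 := by
      rw [ZMod.natCast_eq_zero_iff, Nat.dvd_iff_mod_eq_zero]
    have e2 : (n : ZMod p) + 1 = 0 ↔ n % p = p - 1 := by
      have : (n : ZMod p) = ((p - 1 : ℕ) : ZMod p) ↔ n % p = p - 1 := by
        rw [ZMod.natCast_eq_natCast_iff', Nat.mod_eq_of_lt (Nat.sub_lt hpos one_pos)]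
      rw [← this, Nat.cast_sub hpos]
      simp [eq_neg_iff_add_eq_zero]
    simp only [h, Polynomial.eval_sub, Polynomial.eval_pow, Polynomial.eval_add,
      Polynomial.eval_X, Polynomial.eval_C, ZMod.pow_card_sub_one, ← e1, ← e2]
    split_ifs <;> simp_all
  simp only [heval, sub_mul, mul_sub, sum_sub_distrib] at key
  rw [sum_range_four_mul hpos _ (by intro n hn; simp [hn]),
    sum_range_four_mul (Nat.sub_lt hpos one_pos) _ (by intro n hn; simp [hn])] at key
  rw [← Nat.add_sub_assoc hpos, ← Nat.add_sub_assoc hpos, ← Nat.add_sub_assoc hpos,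
    show p + p - 1 = 2 * p - 1 by omega, show 2 * p + p - 1 = 3 * p - 1 by omega,
    show 3 * p + p - 1 = 4 * p - 1 by omega] at key
  have m2 : (2 * p - 1) % p = p - 1 := by
    rw [show 2 * p - 1 = p + (p - 1) by omega, Nat.add_mod_left,
      Nat.mod_eq_of_lt (Nat.sub_lt hpos one_pos)]
  have o3 : Odd (3 * p) := Odd.mul (by decide) hodd
  have e1 : Even (p - 1) := by obtain ⟨t, rfl⟩ := hodd; exact ⟨t, by omega⟩
  have o2 : Odd (2 * p - 1) := ⟨p - 1, by omega⟩
  rw [count_eq_zero_of_card_lt (n := 3 * p - 1) (by omega),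
    count_eq_zero_of_card_lt (n := 4 * p - 1) (by omega)] at key
  simp only [add_zero, count_zero, hodd.neg_one_pow, (even_two_mul p).neg_one_pow,
    count_eq_zero_of_card_lt (n := 3 * p) (show #J < _ by omega), m2,
    o2.neg_one_pow, e1.neg_one_pow, pow_zero, Nat.mod_self, Nat.zero_mod, Nat.mul_mod_left,
    Nat.mod_eq_of_lt (Nat.sub_lt hpos one_pos)] at key
  simp only [if_true, mul_zero, add_zero] at key
  linear_combination key

/-- Lucas' theorem. -/
lemma choose_self_add {r : ℕ} (c : ℕ) (hr : r < p) : ((c * p + r).choose p : ZMod p) = c := by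
  have := (ZMod.natCast_eq_natCast_iff _ _ _).2
    (Choose.choose_modEq_choose_mod_mul_choose_div_nat (n := c * p + r) (k := p) (p := p))
  rw [this, Nat.mul_add_mod', Nat.mod_eq_of_lt hr, Nat.mod_self, Nat.div_self hp.out.pos,
    Nat.mul_comm c, Nat.mul_add_div hp.out.pos, Nat.div_eq_of_lt hr]
  simp

lemma count_two_mul_of_count_eq_zero (hodd : Odd p) {D : Finset ι} (hD : 3 * (p - 1) < #D)
    (hD' : #D < 3 * p) (h0 : count a b p D = 0) : count a b (2 * p) D = -1 := by
  have := count_alternating_zero a b hodd hD (by omega)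
  rw [h0, count_eq_zero_of_card_lt hD'] at this
  linear_combination this

variable [DecidableEq ι]

lemma count_alternating_averaged (a b : ι → ZMod p) (hodd : Odd p) {J : Finset ι}
    (hJ : #J = 4 * p - 3) :
    3 - 2 * count a b (p - 1) J - 2 * count a b p J + count a b (2 * p - 1) J
      + count a b (2 * p) J = 0 := by
  have hp3 : 3 ≤ p := by
    have := hp.out.two_le
    obtain ⟨t, rfl⟩ := hodd
    omega
  have key : ∑ B ∈ powersetCard p J, (count a b 0 (J \ B) - count a b (p - 1) (J \ B)
      - count a b p (J \ B) + count a b (2 * p - 1) (J \ B) + count a b (2 * p) (J \ B)) = 0 :=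
    sum_eq_zero fun B hB => by
      rw [mem_powersetCard] at hB
      rw [count_zero]
      refine count_alternating_of_card_eq a b hodd ?_
      rw [card_sdiff_of_subset hB.1]
      omega
  simp only [sum_add_distrib, sum_sub_distrib, sum_count_sdiff] at key
  rw [show #J - 0 = 3 * p + (p - 3) by omega, show #J - (p - 1) = 2 * p + (p - 2) by omega,
    show #J - p = 2 * p + (p - 3) by omega, show #J - (2 * p - 1) = 1 * p + (p - 2) by omega,
    show #J - 2 * p = 1 * p + (p - 3) by omega, choose_self_add _ (by omega),
    choose_self_add _ (by omega), choose_self_add _ (by omega), choose_self_add _ (by omega),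
    choose_self_add _ (by omega), count_zero] at key
  push_cast at key
  linear_combination key

/-- Count disjoint zero-sum pairs `(A, C)` of sizes `p - 1` and `2p` in two ways. Each zero-sum `A`,
and likewise each zero-sum union `A ∪ C = J \ B` of size `3p - 1`, admits `-1` choices of `C` mod
`p`. -/
lemma count_pred_eq (hodd : Odd p) {J : Finset ι} (hJ : #J = 4 * p - 3)
    (h0 : ∀ D ⊆ J, count a b p D = 0) : count a b (p - 1) J = count a b (3 * p - 1) J := by
  have hp3 : 3 ≤ p := by
    have := hp.out.two_le
    obtain ⟨t, rfl⟩ := hodd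
    omega
  have h1 : ∑ C ∈ powersetCard (2 * p) J, ∑ A ∈ powersetCard (p - 1) (J \ C),
      zeroSum a b A * zeroSum a b C = - count a b (p - 1) J := by
    rw [← sum_powersetCard_sdiff_comm, count, ← sum_neg_distrib]
    refine sum_congr rfl fun A hA => ?_
    rw [mem_powersetCard] at hA
    have hc := card_sdiff_of_subset hA.1
    rw [← mul_sum, ← count, count_two_mul_of_count_eq_zero hodd (by omega) (by omega)
      (h0 _ sdiff_subset), mul_neg_one]
  have h2 : ∑ C ∈ powersetCard (2 * p) J, ∑ B ∈ powersetCard (p - 2) (J \ C),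
      zeroSum a b (J \ B) * zeroSum a b C = - count a b (3 * p - 1) J := by
    rw [← sum_powersetCard_sdiff_comm, count,
      ← sum_powersetCard_compl (show p - 2 + (3 * p - 1) = #J by omega), ← sum_neg_distrib]
    refine sum_congr rfl fun B hB => ?_
    rw [mem_powersetCard] at hB
    have hc := card_sdiff_of_subset hB.1
    rw [← mul_sum, ← count, count_two_mul_of_count_eq_zero hodd (by omega) (by omega)
      (h0 _ sdiff_subset), mul_neg_one]
  rw [← neg_inj, ← h1, ← h2]
  refine sum_congr rfl fun C hC => ?_
  rw [mem_powersetCard] at hC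
  have hc := card_sdiff_of_subset hC.1
  rw [← sum_powersetCard_compl (show p - 2 + (p - 1) = #(J \ C) by omega)]
  refine sum_congr rfl fun B hB => ?_
  rw [mem_powersetCard, subset_sdiff] at hB
  rw [zeroSum_mul_zeroSum_sdiff (subset_sdiff.2 ⟨hC.1, hB.1.2.symm⟩), mul_comm, sdiff_right_comm]

/-- Dropping a point from a zero-sum `3p`-set leaves a set containing a zero-sum `2p`-set, whose
complement in the `3p`-set is a zero-sum `p`-set. -/
lemma count_three_mul_eq_zero (hodd : Odd p) {J : Finset ι}
    (h0 : ∀ D ⊆ J, count a b p D = 0) (hno : ∀ I ⊆ J, #I = p → zeroSum a b I ≠ 1) :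
    count a b (3 * p) J = 0 := by
  by_contra hne
  obtain ⟨D, hDJ, hD, hD1⟩ := exists_of_count_ne_zero hne
  have hpos := hp.out.pos
  obtain ⟨x, hx⟩ : D.Nonempty := card_pos.1 (by omega)
  have hc := card_erase_of_mem hx
  have h2 := count_two_mul_of_count_eq_zero (a := a) (b := b) hodd (D := D.erase x)
    (by have := hp.out.two_le; omega) (by omega) (h0 _ ((erase_subset _ _).trans hDJ))
  obtain ⟨C, hCD, hC, hC1⟩ := exists_of_count_ne_zero (by rw [h2]; simp)
  have hCD' := hCD.trans (erase_subset _ _)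
  refine hno (D \ C) (sdiff_subset.trans hDJ) ?_ ?_
  · rw [card_sdiff_of_subset hCD', hD, hC]
    omega
  · simpa [hC1, hD1] using (zeroSum_mul_zeroSum_sdiff (a := a) (b := b) hCD').symm

/-- Reiher's theorem for odd primes. -/
theorem exists_zeroSum_of_odd (a b : ι → ZMod p) (hodd : Odd p) {J : Finset ι}
    (hJ : #J = 4 * p - 3) :
    ∃ I ⊆ J, #I = p ∧ ∑ i ∈ I, a i = 0 ∧ ∑ i ∈ I, b i = 0 := by
  simp_rw [← zeroSum_eq_one_iff]
  by_contra! hno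
  have h0 : ∀ D ⊆ J, count a b p D = 0 := fun D hD => by
    by_contra hne
    obtain ⟨I, hI, hIp, hI1⟩ := exists_of_count_ne_zero hne
    exact hno I (hI.trans hD) hIp hI1
  have h2 := hp.out.two_le
  have e1 := count_alternating_zero a b hodd (J := J) (by omega) (by omega)
  have e2 := count_alternating_pred a b hodd (J := J) (by omega) (by omega)
  have e3 := count_alternating_averaged a b hodd hJ
  have e4 := count_pred_eq (a := a) (b := b) hodd hJ h0
  rw [count_three_mul_eq_zero hodd h0 hno, h0 J subset_rfl] at e1
  rw [h0 J subset_rfl] at e3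
  have : ((2 : ℕ) : ZMod p) = 0 := by
    push_cast
    linear_combination e3 - e1 + e2 + e4
  rw [ZMod.natCast_eq_zero_iff] at this
  have := Nat.le_of_dvd two_pos this
  obtain ⟨t, rfl⟩ := hodd
  omega

/-- Among five points of `(ℤ/2ℤ)²`, two coincide. -/
theorem exists_zeroSum_two (a b : ι → ZMod 2) {J : Finset ι} (hJ : #J = 5) :
    ∃ I ⊆ J, #I = 2 ∧ ∑ i ∈ I, a i = 0 ∧ ∑ i ∈ I, b i = 0 := by
  obtain ⟨x, hx, y, hy, hxy, h⟩ := exists_ne_map_eq_of_card_lt_of_maps_to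
    (s := J) (t := (univ : Finset (ZMod 2 × ZMod 2))) (f := fun i => (a i, b i))
    (by rw [hJ]; decide) (by simp)
  rw [Prod.mk.injEq] at h
  refine ⟨{x, y}, by simp [insert_subset_iff, hx, hy], card_pair hxy, ?_, ?_⟩
  · rw [sum_pair hxy, h.1, CharTwo.add_self_eq_zero]
  · rw [sum_pair hxy, h.2, CharTwo.add_self_eq_zero]

end Prime
end Kemnitz

/-! ### From primes to all moduli -/

namespace Kemnitz

open Finset

lemma exists_dvd_sum_of_prime {ι : Type*} {p : ℕ} [hp : Fact p.Prime] (a b : ι → ℤ) {J : Finset ι}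
    (hJ : #J = 4 * p - 3) :
    ∃ I ⊆ J, #I = p ∧ (p : ℤ) ∣ ∑ i ∈ I, a i ∧ (p : ℤ) ∣ ∑ i ∈ I, b i := by
  classical
  simp_rw [← ZMod.intCast_zmod_eq_zero_iff_dvd, Int.cast_sum]
  rcases hp.out.eq_two_or_odd' with rfl | hodd
  · exact exists_zeroSum_two _ _ hJ
  · exact exists_zeroSum_of_odd _ _ hodd hJ

/-- Kemnitz's conjecture: among `4 * n - 3` lattice points there are `n` whose centroid is a lattice
point. -/
theorem exists_dvd_sum {ι : Type*} {n : ℕ} (hn : 0 < n) (a b : ι → ℤ) {J : Finset ι}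
    (hJ : 4 * n - 3 ≤ #J) :
    ∃ I ⊆ J, #I = n ∧ (n : ℤ) ∣ ∑ i ∈ I, a i ∧ (n : ℤ) ∣ ∑ i ∈ I, b i := by
  classical
  induction n using Nat.prime_composite_induction generalizing ι with
  | zero => exact absurd hn (lt_irrefl 0)
  | one => simpa using exists_subset_card_eq hJ
  | prime p hp =>
    have := Fact.mk hp
    obtain ⟨t, hts, ht⟩ := exists_subset_card_eq hJ
    obtain ⟨u, hut, hu⟩ := exists_dvd_sum_of_prime a b ht
    exact ⟨u, hut.trans hts, hu⟩
  | composite m hm ihm n hn' ihn =>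
    -- Extract `4m - 3` disjoint `n`-blocks greedily, then apply the case `m` to the block sums
    -- divided by `n`.
    suffices ∀ k ≤ 4 * m - 3, ∃ 𝒜 : Finset (Finset ι), #𝒜 = k ∧
      (𝒜 : Set (Finset ι)).Pairwise _root_.Disjoint ∧
        ∀ ⦃t⦄, t ∈ 𝒜 → t ⊆ J ∧ #t = n ∧ (n : ℤ) ∣ ∑ i ∈ t, a i ∧ (n : ℤ) ∣ ∑ i ∈ t, b i by
      obtain ⟨𝒜, h𝒜card, h𝒜disj, h𝒜⟩ := this _ le_rfl
      obtain ⟨ℬ, hℬ𝒜, hℬcard, hℬa, hℬb⟩ := ihm (by omega) (fun t ↦ (∑ i ∈ t, a i) / n)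
        (fun t ↦ (∑ i ∈ t, b i) / n) h𝒜card.ge
      have hsum : ∀ c : ι → ℤ, (∀ t ∈ ℬ, (n : ℤ) ∣ ∑ i ∈ t, c i) →
          (m : ℤ) ∣ ∑ t ∈ ℬ, (∑ i ∈ t, c i) / n →
          ((m * n : ℕ) : ℤ) ∣ ∑ i ∈ ℬ.biUnion fun x ↦ x, c i := fun c hc hm => by
        rwa [sum_biUnion (h𝒜disj.mono hℬ𝒜), Int.natCast_mul, mul_comm,
          ← Int.dvd_div_iff_mul_dvd (dvd_sum hc), Int.sum_div hc]
      refine ⟨ℬ.biUnion fun x ↦ x, biUnion_subset.2 fun t ht ↦ (h𝒜 <| hℬ𝒜 ht).1, ?_,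
        hsum a (fun t ht ↦ (h𝒜 <| hℬ𝒜 ht).2.2.1) hℬa, hsum b (fun t ht ↦ (h𝒜 <| hℬ𝒜 ht).2.2.2) hℬb⟩
      rw [card_biUnion (h𝒜disj.mono hℬ𝒜), sum_const_nat fun t ht ↦ (h𝒜 <| hℬ𝒜 ht).2.1, hℬcard]
    rintro k hk
    induction k with
    | zero => exact ⟨∅, by simp⟩
    | succ k ih =>
      obtain ⟨𝒜, h𝒜card, h𝒜disj, h𝒜⟩ := ih (Nat.le_of_succ_le hk)
      have : 4 * n - 3 ≤ #(J \ 𝒜.biUnion id) := by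
        have h1 : #(𝒜.biUnion id) ≤ k * n := by
          rw [← h𝒜card, ← sum_const_nat fun t ht ↦ (h𝒜 ht).2.1]
          exact card_biUnion_le
        refine le_trans ?_ (le_card_sdiff (𝒜.biUnion id) J)
        have h3 : k * n + 4 * n ≤ 4 * (m * n) := by
          rw [← add_mul, ← mul_assoc]
          exact Nat.mul_le_mul_right n (by omega)
        clear ih ihm ihn h𝒜
        omega
      obtain ⟨t₀, ht₀, ht₀card, ht₀sum⟩ := ihn (two_pos.trans_le hn') a b this
      have : t₀ ∉ 𝒜 := by
        rintro h
        obtain rfl : n = 0 := by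
          simpa [← card_eq_zero, ht₀card] using
            sdiff_disjoint.mono ht₀ <| subset_biUnion_of_mem id h
        omega
      refine ⟨𝒜.cons t₀ this, by rw [card_cons, h𝒜card], ?_, ?_⟩
      · simp only [cons_eq_insert, coe_insert, Set.pairwise_insert_of_symm, mem_coe, ne_eq]
        exact ⟨h𝒜disj, fun t ht _ ↦ sdiff_disjoint.mono ht₀ <| subset_biUnion_of_mem id ht⟩
      · simp only [cons_eq_insert, mem_insert, forall_eq_or_imp, and_assoc]
        exact ⟨ht₀.trans sdiff_subset, ht₀card, ht₀sum.1, ht₀sum.2, h𝒜⟩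

/-- Kemnitz's conjecture, for multisets over an arbitrary type mapped to `(ℤ/nℤ)²`. -/
theorem exists_le_sum_map_eq_zero {α : Type*} [DecidableEq α] {n : ℕ} (hn : 0 < n)
    (a b : α → ZMod n) {S : Multiset α} (hS : 4 * n - 3 ≤ S.card) :
    ∃ T ≤ S, T.card = n ∧ (T.map a).sum = 0 ∧ (T.map b).sum = 0 := by
  have : NeZero n := ⟨hn.ne'⟩
  -- `toEnumFinset` labels repeated elements apart, so index subsets give submultisets.
  obtain ⟨I, hI, hcard, ha, hb⟩ := exists_dvd_sum hn (J := S.toEnumFinset)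
    (fun i => ((a i.1).cast : ℤ)) (fun i => ((b i.1).cast : ℤ)) (by simpa using hS)
  refine ⟨I.1.map Prod.fst, Multiset.map_fst_le_of_subset_toEnumFinset hI, by simpa using hcard,
    ?_, ?_⟩
  · simpa [← ZMod.intCast_zmod_eq_zero_iff_dvd, Multiset.map_map] using ha
  · simpa [← ZMod.intCast_zmod_eq_zero_iff_dvd, Multiset.map_map] using hb

end Kemnitz

/-! ### Newton's identities and elementary symmetric sums -/

section ElementarySymmetric

lemma Multiset.exists_le_map_eq {α β : Type*} {f : α → β} {S : Multiset α}
    {T : Multiset β} (h : T ≤ S.map f) : ∃ U ≤ S, U.map f = T := by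
  classical
  induction S using Multiset.induction generalizing T with
  | empty => exact ⟨0, le_rfl, by simpa [eq_comm] using h⟩
  | cons a S ih =>
    rw [Multiset.map_cons, ← Multiset.erase_le_iff_le_cons] at h
    obtain ⟨U, hU, hUT⟩ := ih h
    by_cases ha : f a ∈ T
    · exact ⟨a ::ₘ U, Multiset.cons_le_cons a hU, by
        rw [Multiset.map_cons, hUT, Multiset.cons_erase ha]⟩
    · exact ⟨U, hU.trans (Multiset.le_cons_self S a), by
        rw [hUT, Multiset.erase_of_notMem ha]⟩

lemma Multiset.esymm_one_eq_sum {R : Type*} [CommRing R] (S : Multiset R) :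
    S.esymm 1 = S.sum := by
  simp [Multiset.esymm, Multiset.powersetCard_one, Multiset.map_map]

lemma Multiset.mul_esymm_eq_sum {R : Type*} [CommRing R] (S : Multiset R) (m : ℕ) :
    (m : R) * S.esymm m = (-1) ^ (m + 1) * ∑ x ∈ Finset.HasAntidiagonal.antidiagonal m with x.1 < m,
      (-1) ^ x.1 * S.esymm x.1 * (S.map (· ^ x.2)).sum := by
  classical
  obtain ⟨l, rfl⟩ : ∃ l : List R, S = l := ⟨S.toList, S.coe_toList.symm⟩
  have hmap : (Finset.univ : Finset (Fin l.length)).val.map l.get = (l : Multiset R) := by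
    simp [Fin.univ_val_map]
  have h := congrArg (MvPolynomial.aeval (R := ℤ) l.get)
    (MvPolynomial.mul_esymm_eq_sum (Fin l.length) ℤ m)
  simp only [map_mul, map_natCast, map_pow, map_neg, map_one, map_sum, MvPolynomial.psum,
    MvPolynomial.aeval_X, MvPolynomial.aeval_esymm_eq_multiset_esymm, hmap] at h
  rw [h]
  congr 1
  refine Finset.sum_congr rfl fun x _ => ?_
  rw [← hmap, Multiset.map_map]
  rfl

lemma Multiset.esymm_eq_zero_of_sum_pow_eq_zero {R : Type*} [CommRing R] {S : Multiset R} {m : ℕ}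
    (hm : 0 < m) (hunit : IsUnit (m.factorial : R))
    (hpow : ∀ i, 0 < i → i ≤ m / 2 ∨ i = m → (S.map (· ^ i)).sum = 0) : S.esymm m = 0 := by
  have hcast : ∀ i, 0 < i → i ≤ m → IsUnit (i : R) := fun i hi him =>
    isUnit_of_dvd_unit (Nat.cast_dvd_cast (Nat.dvd_factorial hi him)) hunit
  have hsmall : ∀ i, 0 < i → i ≤ m / 2 → S.esymm i = 0 := fun i hi him => by
    have h := S.mul_esymm_eq_sum i
    rw [Finset.sum_eq_zero fun x hx => ?_, mul_zero] at h
    · exact ((hcast i hi (him.trans (Nat.div_le_self _ _))).mul_right_eq_zero).1 h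
    · rw [Finset.mem_filter, Finset.HasAntidiagonal.mem_antidiagonal] at hx
      rw [hpow x.2 (by omega) (Or.inl (by omega)), mul_zero]
  have h := S.mul_esymm_eq_sum m
  rw [Finset.sum_eq_zero fun x hx => ?_, mul_zero] at h
  -- In each remaining term either `x.1 = 0`, or `x.1 ≤ m / 2`, or `x.2 ≤ m / 2`.
  · exact ((hcast m hm le_rfl).mul_right_eq_zero).1 h
  · rw [Finset.mem_filter, Finset.HasAntidiagonal.mem_antidiagonal] at hx
    rcases Nat.eq_zero_or_pos x.1 with h0 | h0
    · rw [hpow x.2 (by omega) (Or.inr (by omega)), mul_zero]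
    by_cases h1 : x.1 ≤ m / 2
    · rw [hsmall x.1 h0 h1, mul_zero, zero_mul]
    · rw [hpow x.2 (by omega) (Or.inl (by omega)), mul_zero]

/-- Here `e_2` occurs only multiplied by `p_1 = 0`, so 2 need not be invertible. -/
lemma Multiset.esymm_three_eq_zero {R : Type*} [CommRing R] {S : Multiset R}
    (h3 : IsUnit (3 : R)) (h1 : S.sum = 0) (hcube : (S.map (· ^ 3)).sum = 0) :
    S.esymm 3 = 0 := by
  have hone : S.esymm 1 = 0 := by rw [Multiset.esymm_one_eq_sum, h1]
  have h := S.mul_esymm_eq_sum 3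
  have hf : (Finset.HasAntidiagonal.antidiagonal 3).filter (fun x : ℕ × ℕ => x.1 < 3) = {(0, 3), (1, 2), (2, 1)} := by
    decide
  rw [hf, Finset.sum_eq_zero fun x hx => ?_, mul_zero] at h
  · exact (IsUnit.mul_right_eq_zero (by exact_mod_cast h3)).1 h
  · simp only [Finset.mem_insert, Finset.mem_singleton] at hx
    rcases hx with rfl | rfl | rfl <;> simp [hcube, hone, h1]

lemma Multiset.esymm_zero_cons {R : Type*} [CommRing R] (S : Multiset R) (m : ℕ) :
    (0 ::ₘ S).esymm m = S.esymm m := by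
  cases m <;> simp [Multiset.esymm]

lemma Multiset.esymm_add_replicate_zero {R : Type*} [CommRing R] (S : Multiset R) (n m : ℕ) :
    (S + Multiset.replicate n 0).esymm m = S.esymm m := by
  induction n with
  | zero => simp
  | succ n ih => rw [Multiset.replicate_succ, Multiset.add_cons, Multiset.esymm_zero_cons, ih]

lemma Multiset.esymm_replicate_one {R : Type*} [CommRing R] (n m : ℕ) :
    (Multiset.replicate n (1 : R)).esymm m = n.choose m := by
  rw [Multiset.esymm, Multiset.map_congr rfl fun t ht => ?_, Multiset.map_const',
    Multiset.sum_replicate, Multiset.card_powersetCard, Multiset.card_replicate, nsmul_one]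
  exact Multiset.prod_eq_one fun x hx =>
    Multiset.eq_of_mem_replicate (Multiset.mem_of_le (Multiset.mem_powersetCard.1 ht).1 hx)

end ElementarySymmetric

/-! ### Bounds for the constants -/

section Constants

lemma IsPrimePow.not_dvd_choose_three {q : ℕ} (hq : IsPrimePow q) {n : ℕ} (h3 : 3 ≤ n)
    (hn : n < q) : ¬ q ∣ n.choose 3 := by
  obtain ⟨p, a, hp, -, rfl⟩ := hq
  have hp := hp.nat_prime
  intro hdvd
  -- A prime power dividing `n.choose 3` is at most `n`.
  have hle := (hp.pow_dvd_iff_le_factorization (Nat.choose_pos h3).ne').1 hdvd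
  have := Nat.pow_le_of_le_log (by omega) (hle.trans Nat.factorization_choose_le_log)
  omega

lemma le_davenportConst_three {q : ℕ} (hq : IsPrimePow q) :
    (q : ℕ∞) ≤ davenportConst 3 (ZMod q) := by
  refine le_sInf ?_
  rintro _ ⟨z, ⟨-, hz⟩, rfl⟩
  by_contra! hlt
  have hlt : z < q := Nat.cast_lt.1 hlt
  obtain ⟨S', hle, hcard, hzero⟩ := hz (Multiset.replicate (q - 1) 1) (by
    rw [Multiset.card_replicate]; omega)
  obtain ⟨n, hn, rfl⟩ := Multiset.le_replicate_iff.1 hle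
  rw [Multiset.card_replicate] at hcard
  rw [Multiset.esymm_replicate_one, ZMod.natCast_eq_zero_iff] at hzero
  exact hq.not_dvd_choose_three hcard (by omega) hzero

lemma card_le_of_egz {R : Type*} [CommRing R] {k m z : ℕ}
    (hz : ∀ S : Multiset R, z ≤ S.card → ∃ S' : Multiset R, S' ≤ S ∧ S'.card = k ∧ S'.esymm m = 0) :
    k ≤ z := by
  obtain ⟨S', hle, hcard, -⟩ := hz (Multiset.replicate z 0) (by simp)
  simpa [hcard] using Multiset.card_le_card hle

lemma add_davenportConst_le_egzConst {R : Type*} [CommRing R] {k m : ℕ} (hm : 0 < m)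
    (hk : m ≤ k) : (k : ℕ∞) + davenportConst m R - m ≤ egzConst k R m := by
  classical
  refine le_sInf ?_
  rintro _ ⟨z, ⟨-, hz⟩, rfl⟩
  have hkz := card_le_of_egz hz
  have hD : davenportConst m R ≤ ((z + m - k : ℕ) : ℕ∞) := by
    refine sInf_le ⟨z + m - k, ⟨by omega, fun T hT => ?_⟩, rfl⟩
    obtain ⟨S', hle, hcard, hzero⟩ := hz (T + Multiset.replicate (k - m) 0) (by
      rw [Multiset.card_add, Multiset.card_replicate]; omega)
    refine ⟨S' - Multiset.replicate (k - m) 0, tsub_le_iff_right.2 hle, ?_, ?_⟩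
    -- At most `k - m` of the `k` terms are removed, so at least `m` remain.
    · have := Multiset.card_le_card
        (tsub_le_iff_right.1 (le_refl (S' - Multiset.replicate (k - m) 0)))
      rw [Multiset.card_add, Multiset.card_replicate, hcard] at this
      omega
    -- The removed terms are all zeros; restoring them recovers `S'` without changing `e_m`.
    · obtain ⟨j, -, hj⟩ := Multiset.le_replicate_iff.1
        (Multiset.inter_le_right (s := S') (t := Multiset.replicate (k - m) 0))
      rw [← Multiset.esymm_add_replicate_zero _ j, ← hj, Multiset.sub_add_inter, hzero]
  refine (tsub_le_tsub_right (add_le_add_right hD _) _).trans ?_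
  have h : k + (z + m - k) - m ≤ z := by omega
  change _ ≤ (z : ℕ∞)
  exact_mod_cast h

lemma one_le_egzConst {R : Type*} [CommRing R] (k m : ℕ) : 1 ≤ egzConst k R m := by
  refine le_sInf ?_
  rintro _ ⟨z, ⟨hpos, -⟩, rfl⟩
  exact Nat.one_le_cast.2 hpos

lemma egzConst_le_egzConst_powers {k m : ℕ} (hm : 0 < m) (h : k.Coprime m.factorial) {d : ℕ}
    (hd : d = m / 2 + 1) :
    egzConst k (ZMod k) m ≤ egzConst k (Fin d → ZMod k) 1 := by
  classical
  subst hd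
  -- Inclusion of the sets of admissible `z` also covers an infinite right-hand side.
  refine sInf_le_sInf (Set.image_mono ?_)
  rintro z ⟨hpos, hz⟩
  refine ⟨hpos, fun S hS => ?_⟩
  let φ : ZMod k → Fin (m / 2 + 1) → ZMod k :=
    fun g j => if (j : ℕ) < m / 2 then g ^ (j + 1 : ℕ) else g ^ m
  obtain ⟨T', hle, hcard, hzero⟩ := hz (S.map φ) (by simpa using hS)
  obtain ⟨T, hT, rfl⟩ := Multiset.exists_le_map_eq hle
  have hsum : ∀ j, (T.map fun g => φ g j).sum = 0 := fun j => by
    rw [Multiset.esymm_one_eq_sum] at hzero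
    have := congrArg (Pi.evalAddMonoidHom (fun _ => ZMod k) j) hzero
    rwa [AddMonoidHom.map_multiset_sum, Multiset.map_map] at this
  refine ⟨T, hT, by simpa using hcard, Multiset.esymm_eq_zero_of_sum_pow_eq_zero hm ?_ ?_⟩
  · exact (ZMod.isUnit_iff_coprime _ _).2 h.symm
  · rintro i hi (him | rfl)
    · have := hsum ⟨i - 1, by omega⟩
      simpa [φ, show i - 1 < m / 2 by omega, Nat.sub_add_cancel hi] using this
    · simpa [φ] using hsum (Fin.last _)

lemma egzConst_three_le {k : ℕ} (hk : 0 < k) (h : k.Coprime 3) :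
    egzConst k (ZMod k) 3 ≤ ((4 * k - 3 : ℕ) : ℕ∞) := by
  refine sInf_le ⟨_, ⟨by omega, fun S hS => ?_⟩, rfl⟩
  obtain ⟨T, hT, hcard, h1, h3⟩ :=
    Kemnitz.exists_le_sum_map_eq_zero hk (fun g : ZMod k => g) (fun g => g ^ 3) hS
  refine ⟨T, hT, hcard, Multiset.esymm_three_eq_zero ?_ (by simpa using h1) h3⟩
  exact_mod_cast (ZMod.isUnit_iff_coprime 3 k).2 h.symm

lemma davenportConst_le_of_subsingleton {R : Type*} [CommRing R] [Subsingleton R] {m : ℕ}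
    (hm : 0 < m) : davenportConst m R ≤ m :=
  sInf_le ⟨m, ⟨hm, fun S hS => ⟨S, le_rfl, hS, Subsingleton.elim _ _⟩⟩, rfl⟩

end Constants

theorem mainTheorem6 :
    ((∀ k m : ℕ, 0 < k → 0 < m → Nat.gcd k m.factorial = 1 →
        egzConst k (ZMod k) m ≤ egzConst k (Fin ⌈((m : ℚ) + 1) / 2⌉₊ → ZMod k) 1) ∧
      (∀ k : ℕ, 0 < k → Nat.gcd k 3 = 1 →
        egzConst k (ZMod k) 3 ≤ 4 * (k : ℕ∞) - 3)) ∧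
    (∀ k : ℕ, 0 < k → k ≠ 2 → Nat.gcd k 3 = 1 →
      (k : ℕ∞) + davenportConst 3 (ZMod k) - 3 ≤ egzConst k (ZMod k) 3) ∧
    (∀ q : ℕ, IsPrimePow q →
      2 * (q : ℕ∞) - 3 ≤ egzConst q (ZMod q) 3) := by
  refine ⟨⟨fun k m _ hm h => ?_, fun k hk h => ?_⟩, fun k hk hk2 _ => ?_, fun q hq => ?_⟩
  · refine egzConst_le_egzConst_powers hm h ?_
    rw [Nat.ceil_eq_iff (by omega)]
    have h1 : 2 * (m / 2) ≤ m := Nat.mul_div_le m 2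
    have h2 : m ≤ 2 * (m / 2) + 1 := by omega
    have h1' : (2 : ℚ) * (m / 2 : ℕ) ≤ m := by exact_mod_cast h1
    have h2' : (m : ℚ) ≤ 2 * (m / 2 : ℕ) + 1 := by exact_mod_cast h2
    rw [Nat.add_sub_cancel]
    push_cast at *
    constructor <;> linarith
  · refine (egzConst_three_le hk h).trans (le_of_eq ?_)
    norm_cast
  · rcases Nat.lt_or_ge k 3 with hlt | hge
    -- The padding needs `k ≥ 3`; since `k ≠ 2`, only the zero ring is left, where `D_3 ≤ 3`.
    · obtain rfl : k = 1 := by omega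
      have : Subsingleton (ZMod 1) := inferInstanceAs (Subsingleton (Fin 1))
      refine le_trans ?_ (one_le_egzConst 1 3)
      refine tsub_le_iff_right.2 (add_le_add le_rfl ?_)
      exact davenportConst_le_of_subsingleton (by norm_num)
    · exact add_davenportConst_le_egzConst (by norm_num) hge
  · rcases Nat.lt_or_ge q 3 with hlt | hge
    · obtain rfl : q = 2 := by have := hq.two_le; omega
      exact le_trans (by norm_cast) (one_le_egzConst 2 3)
    · refine le_trans ?_ (add_davenportConst_le_egzConst (by norm_num) hge)
      rw [two_mul]
      exact tsub_le_tsub_right (add_le_add le_rfl (le_davenportConst_three hq)) _
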